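/- Let $M\ge 1$ and let $I$ be a finite input sequence of pairwise distinct elements of a linearly ordered set. An algorithm with a buffer of size $K$ reads the elements of $I$ in order into free buffer slots and writes elements out of its buffer, appending them to an output sequence $S$, until every element is written. A run is a sorted or reverse-sorted sequence; $R(S)$ is the least number of runs whose concatenation is $S$, and $\mathrm{OPT}_K(I)$ is the minimum of $R(S)$ over all outputs $S$ that are possible on $I$ with a buffer of size $K$. The unwritten-element sequence is the list of all elements not yet written, in order of arrival. The maximal up run for buffer size $K$ keeps the buffer full as long as input remains, starts with the smallest element in the buffer, always writes next the smallest buffer element larger than the last one written, and ends when there is none; maximal down runs are defined symmetrically. The greedy direction (for buffer size $M$) on a sequence is "up" if its initial maximal up run for buffer size $M$ is longer than its initial maximal down run for buffer size $M$, and "down" otherwise. Let $A$ be the following deterministic online algorithm with a buffer of size $4M$, kept in arrival order and kept full as long as input remains. At each decision point (at the start, and whenever no buffered element can continue the current run), $A$ looks only at its buffer contents $b_1,b_2,\dots$ and simulates, without writing, the maximal up run and the maximal down run of an $M$-size buffer: for $t=0,1,\dots$ the $(t+1)$-st simulated element is the first admissible one (the smallest larger than the previous simulated element for up, the largest smaller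 than it for down; for $t=0$ the smallest, respectively the largest) among $b_1,\dots,b_{M+t}$; the simulation stops when there is none, or after $3M$ simulated writes. If the simulated up run is longer, $A$ chooses direction up, otherwise down, and it writes one maximal run in that direction using its whole $4M$-size buffer. $A$ stops when no element is left to write. Then: 1. Of the initial maximal up run and the initial maximal down run on $I$ for buffer size $M$, at least one has length less than $3M$. 2. The sequence $S$ that $A$ writes is a possible output on $I$ with a buffer of size $4M$. 3. $S=r_1\circ\cdots\circ r_k$, where each $r_i$ is the maximal run for buffer size $4M$ on the unwritten-element sequence at the $i$-th decision point, taken in the greedy direction (for buffer size $M$) on that whole unwritten-element sequence; and $k\le \mathrm{OPT}_M(I)$. 4. $R(S)\le \mathrm{OPT}_M(I)$. -/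

import Mathlib

namespace UpDown

/-! ### Runs and the cost of an output sequence -/

/-- A run is a sequence that is sorted or reverse-sorted. -/
def IsRun {α : Type*} [LinearOrder α] (r : List α) : Prop :=
  r.Pairwise (fun a b => a ≤ b) ∨ r.Pairwise (fun a b => b ≤ a)

/-- `runCount S` is the smallest number of runs whose concatenation is `S`. -/
noncomputable def runCount {α : Type*} [LinearOrder α] (S : List α) : ℕ :=
  sInf {k | ∃ rs : List (List α), rs.length = k ∧ (∀ r ∈ rs, IsRun r) ∧ rs.flatten = S}

/-! ### Possible outputs with a buffer of size `K`, and the offline optimum -/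

/-- `CanWrite K buf inp S`: starting with buffer contents `buf` and remaining input `inp`, the
whole of `buf` and `inp` can be written out as the sequence `S`, using a buffer with `K` slots.
Input elements are read in order, each into a free slot; any buffered element may be written at
any time, which frees its slot. Slots may be left free, so this is the least restrictive model. -/
inductive CanWrite {α : Type*} (K : ℕ) : List α → List α → List α → Prop
  | done : CanWrite K [] [] []
  | read {buf inp S : List α} {x : α} (hfree : buf.length < K)
      (h : CanWrite K (buf ++ [x]) inp S) : CanWrite K buf (x :: inp) S
  | write {l₁ l₂ inp S : List α} {x : α}
      (h : CanWrite K (l₁ ++ l₂) inp S) : CanWrite K (l₁ ++ x :: l₂) inp (x :: S)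

/-- `S` is a possible output sequence on input `I` with a buffer of size `K`. -/
def IsOutput {α : Type*} (K : ℕ) (I S : List α) : Prop :=
  CanWrite K [] I S

/-- The minimum number of runs of any possible output on input `I` with a buffer of size `K`. -/
noncomputable def OPT {α : Type*} [LinearOrder α] (K : ℕ) (I : List α) : ℕ :=
  sInf {k | ∃ S : List α, IsOutput K I S ∧ runCount S = k}

/-! ### Deterministic online algorithms -/

/-- A deterministic online algorithm. Its next move depends only on its internal state, the last
element written (if any), and the current buffer contents, listed in arrival order. It either
ejects an element of the buffer and updates its state, or halts (`none`). -/
structure OnlineAlgorithm (α : Type*) where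
  State : Type
  init : State
  step : State → Option α → List α → Option (α × State)

/-- Run an online algorithm with a buffer of size `K` for at most `n` writes. Before each write
the buffer is filled from the input as far as possible; the buffer stays in arrival order. -/
def OnlineAlgorithm.exec {α : Type*} [DecidableEq α] (A : OnlineAlgorithm α) (K : ℕ) :
    ℕ → A.State → Option α → List α → List α → List α
  | 0, _, _, _, _ => []
  | n + 1, s, last, buf, inp =>
    let full := buf ++ inp.take (K - buf.length)
    let rest := inp.drop (K - buf.length)
    match A.step s last full with
    | none => []
    | some (x, s') => x :: A.exec K n s' (some x) (full.erase x) rest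

/-- The sequence written by `A` on input `I` with a buffer of size `K`, from an empty buffer until
`A` halts (at most `I.length` elements can be written). -/
def OnlineAlgorithm.output {α : Type*} [DecidableEq α] (A : OnlineAlgorithm α) (K : ℕ)
    (I : List α) : List α :=
  A.exec K I.length A.init none [] I

/-! ### Maximal runs -/

/-- The direction of a run. -/
inductive Dir
  | up
  | down

/-- `d.beyond l x`: `x` is strictly beyond `l` in direction `d`. -/
def Dir.beyond {α : Type*} [LinearOrder α] : Dir → α → α → Bool
  | .up, l, x => decide (l < x)
  | .down, l, x => decide (x < l)

/-- The first element of a list in direction `d`: the smallest for `up`, the largest for `down`. -/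
def Dir.first {α : Type*} [LinearOrder α] : Dir → List α → Option α
  | .up, b => b.min?
  | .down, b => b.max?

/-- The next element of a maximal run in direction `d`, given the last element of the run written
so far (`none` at the start of the run) and the list `b` of available elements. It is `none` if no
available element can continue the run. -/
def Dir.next {α : Type*} [LinearOrder α] (d : Dir) : Option α → List α → Option α
  | none, b => d.first b
  | some l, b => d.first (b.filter (d.beyond l))

/-- The algorithm that writes a single maximal run in direction `d` and then halts. -/
def maximalRunAlg (α : Type*) [LinearOrder α] (d : Dir) : OnlineAlgorithm α where
  State := Unit
  init := ()
  step _ last b := (d.next last b).map fun x => (x, ())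

/-- The initial maximal run in direction `d` on the unwritten-element sequence `u`, with a buffer
of size `K`. -/
def maximalRun {α : Type*} [LinearOrder α] (K : ℕ) (d : Dir) (u : List α) : List α :=
  (maximalRunAlg α d).output K u

/-- The greedy direction on `u` for buffer size `M`: `up` if the maximal up run is longer than the
maximal down run, and `down` otherwise. The whole of `u` is used here. -/
def greedyDir {α : Type*} [LinearOrder α] (M : ℕ) (u : List α) : Dir :=
  if (maximalRun M .down u).length < (maximalRun M .up u).length then .up else .down

/-- `GreedyRuns M K u rs`: the sequence `u` is written out as the list `rs` of consecutive runs,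
where each run is the maximal run for buffer size `K`, in the greedy direction for buffer size `M`,
on the elements that are still unwritten (in arrival order) when the run starts. -/
inductive GreedyRuns {α : Type*} [LinearOrder α] (M K : ℕ) : List α → List (List α) → Prop
  | nil : GreedyRuns M K [] []
  | cons {u : List α} {rs : List (List α)} (hu : u ≠ [])
      (h : GreedyRuns M K (u.diff (maximalRun K (greedyDir M u) u)) rs) :
      GreedyRuns M K u (maximalRun K (greedyDir M u) u :: rs)

/-! ### The algorithm with a buffer of size `4 * M` -/

/-- Simulation, without writing, of a maximal run in direction `d` with an `M`-size buffer, from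
the contents `b` of the large buffer. Only the number `t` of simulated writes and the last
simulated element are stored: after `t` simulated writes, the simulated machine has read the first
`M + t` elements of `b`. At most `n` further writes are simulated. The value is the final `t`. -/
def simulate {α : Type*} [LinearOrder α] (M : ℕ) (d : Dir) (b : List α) :
    ℕ → ℕ → Option α → ℕ
  | 0, t, _ => t
  | n + 1, t, last =>
    match d.next last (b.take (M + t)) with
    | none => t
    | some e => simulate M d b n (t + 1) (some e)

/-- The length of the simulated run; the simulation stops after `3 * M` writes. -/
def simLength {α : Type*} [LinearOrder α] (M : ℕ) (d : Dir) (b : List α) : ℕ :=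
  simulate M d b (3 * M) 0 none

/-- The direction that the algorithm chooses at a decision point, from its buffer contents. -/
def chooseDir {α : Type*} [LinearOrder α] (M : ℕ) (b : List α) : Dir :=
  if simLength M .down b < simLength M .up b then .up else .down

/-- The algorithm (meant for a buffer of size `4 * M`). Its state is the direction of the current
run (`none` before the first one). It continues the current run as a maximal run while possible;
otherwise it is at a decision point, chooses a direction by simulation, and starts a maximal run in
that direction. It halts when there is no element left to write. -/
def augAlg (α : Type*) [LinearOrder α] (M : ℕ) : OnlineAlgorithm α where
  State := Option Dir
  init := none
  step s last b :=
    match s.bind (fun d => d.next last b) with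
    | some x => some (x, s)
    | none => ((chooseDir M b).next none b).map fun x => (x, some (chooseDir M b))

end UpDown

namespace UpDown

/-! With a buffer kept full, the machine state is one list: the unwritten-element sequence `u`,
whose first `K` entries are the buffer. The element with index `j` (from 0) of any run started on
`u` then lies in `u.take (K + j)`. Conversely, a maximal run contains every strictly monotone
sequence of its direction that obeys these window constraints (`subset_maximalRun`).

The central fact is `maximalRun_up_or_down_length_lt`: for buffer size `M`, one of the two maximal
runs has fewer than `3 * M` elements. Hence truncating both simulations at `3 * M` writes preserves
the comparison of lengths, and these writes look only at the first `4 * M` unwritten elements, so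
the algorithm finds the greedy direction (`chooseDir_take`).

For optimality, compare with any output for buffer size `M`. If its first run has the greedy
direction, the larger buffer covers it. If not, it has fewer than `3 * M` elements, so all of them
are already in the buffer of size `4 * M` and are written by a maximal run in either direction. Thus
each greedy run absorbs a whole run of the competitor; deleting the written elements from the
competitor leaves a legal output for what remains, and induction applies (`GreedyRuns.length_le`).
-/

variable {α : Type*}

/-! ### Sliding windows: prefixes after one element is erased. -/

theorem take_erase_of_mem_take [DecidableEq α] {u : List α} {x : α} {k : ℕ}
    (h : x ∈ u.take (k + 1)) : (u.erase x).take k = (u.take (k + 1)).erase x := by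
  induction u generalizing k with
  | nil => simp
  | cons a u ih =>
    by_cases hax : a = x
    · simp [hax]
    · have hx : x ∈ u.take k := by
        simpa [Ne.symm hax] using h
      cases k with
      | zero => simp at hx
      | succ k =>
        rw [List.erase_cons_tail (by simpa using hax), List.take_succ_cons, ih hx,
          List.take_succ_cons, List.erase_cons_tail (by simpa using hax)]

theorem mem_take_of_le {u : List α} {x : α} {k l : ℕ} (hkl : k ≤ l) (h : x ∈ u.take k) :
    x ∈ u.take l :=
  (List.take_sublist_take_left hkl).subset h

theorem mem_take_erase_iff [DecidableEq α] {u : List α} {x y : α} {K j : ℕ}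
    (hx : x ∈ u.take K) (hyx : y ≠ x) :
    y ∈ (u.erase x).take (K + j) ↔ y ∈ u.take (K + j + 1) := by
  rw [take_erase_of_mem_take (mem_take_of_le (by omega) hx), List.mem_erase_of_ne hyx]

/-! ### Choice of the next element -/

section Next

variable [LinearOrder α]

theorem Dir.beyond_irrefl (d : Dir) (x : α) : d.beyond x x = false := by
  cases d <;> simp [Dir.beyond]

theorem Dir.beyond_trans (d : Dir) {x y z : α} (h : d.beyond x y) (h' : d.beyond y z) :
    d.beyond x z := by
  cases d <;> simp only [Dir.beyond, decide_eq_true_eq] at *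
  · exact h.trans h'
  · exact h'.trans h

theorem Dir.ne_of_beyond (d : Dir) {x y : α} (h : d.beyond x y) : y ≠ x := by
  rintro rfl
  simp [d.beyond_irrefl] at h

/-- `y` can continue a run in direction `d` whose last element so far is `last`. -/
def Dir.Admissible (d : Dir) (last : Option α) (y : α) : Prop :=
  ∀ l ∈ last, d.beyond l y = true

theorem Dir.admissible_none (d : Dir) (y : α) : d.Admissible none y := by
  simp [Dir.Admissible]

theorem Dir.admissible_some (d : Dir) (l y : α) :
    d.Admissible (some l) y ↔ d.beyond l y = true := by
  simp [Dir.Admissible]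

/-- Strict `beyond` with `y ≠ x` replaces `≤` and `≥`, so that later arguments treat both directions
at once. -/
theorem Dir.first_eq_some_iff (d : Dir) {b : List α} {x : α} :
    d.first b = some x ↔ x ∈ b ∧ ∀ y ∈ b, y ≠ x → d.beyond x y = true := by
  cases d
  · simp only [Dir.first, Dir.beyond, decide_eq_true_eq, List.min?_eq_some_iff]
    exact and_congr_right fun _ => forall₂_congr fun y _ =>
      ⟨fun h hne => lt_of_le_of_ne h hne.symm, fun h => by
        by_cases hy : y = x
        · exact hy.ge
        · exact (h hy).le⟩
  · simp only [Dir.first, Dir.beyond, decide_eq_true_eq, List.max?_eq_some_iff]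
    exact and_congr_right fun _ => forall₂_congr fun y _ =>
      ⟨fun h hne => lt_of_le_of_ne h hne, fun h => by
        by_cases hy : y = x
        · exact hy.le
        · exact (h hy).le⟩

theorem Dir.first_eq_none_iff (d : Dir) {b : List α} : d.first b = none ↔ b = [] := by
  cases d <;> simp [Dir.first]

theorem Dir.next_eq_some_iff (d : Dir) {last : Option α} {b : List α} {x : α} :
    d.next last b = some x ↔ x ∈ b ∧ d.Admissible last x ∧
      ∀ y ∈ b, d.Admissible last y → y ≠ x → d.beyond x y = true := by
  cases last with
  | none => simp [Dir.next, d.first_eq_some_iff, d.admissible_none]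
  | some l =>
    simp only [Dir.next, d.first_eq_some_iff, d.admissible_some, List.mem_filter]
    tauto

theorem Dir.next_eq_none_iff (d : Dir) {last : Option α} {b : List α} :
    d.next last b = none ↔ ∀ y ∈ b, ¬ d.Admissible last y := by
  cases last with
  | none => simp [Dir.next, d.first_eq_none_iff, d.admissible_none, List.eq_nil_iff_forall_not_mem]
  | some l => simp [Dir.next, d.first_eq_none_iff, d.admissible_some]

theorem Dir.next_congr (d : Dir) {last : Option α} {b b' : List α}
    (h : ∀ y, d.Admissible last y → (y ∈ b ↔ y ∈ b')) : d.next last b = d.next last b' := by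
  ext x
  rw [d.next_eq_some_iff, d.next_eq_some_iff]
  constructor
  · rintro ⟨h1, h2, h3⟩
    exact ⟨(h x h2).1 h1, h2, fun y hy hya => h3 y ((h y hya).2 hy) hya⟩
  · rintro ⟨h1, h2, h3⟩
    exact ⟨(h x h2).2 h1, h2, fun y hy hya => h3 y ((h y hya).1 hy) hya⟩

theorem Dir.Admissible.of_beyond {d : Dir} {last : Option α} {x y : α}
    (hx : d.Admissible last x) (h : d.beyond x y = true) : d.Admissible last y :=
  fun l hl => d.beyond_trans (hx l hl) h

end Next

/-! ### Executions in terms of the unwritten-element sequence -/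

section Exec

theorem CanWrite.fill {K : ℕ} {buf inp S : List α} (j : ℕ) (hj : buf.length + j ≤ K)
    (h : CanWrite K (buf ++ inp.take j) (inp.drop j) S) : CanWrite K buf inp S := by
  induction j generalizing buf inp with
  | zero => simpa using h
  | succ j ih =>
    cases inp with
    | nil => simpa using h
    | cons x inp =>
      refine .read (by omega) (ih (by simp; omega) ?_)
      simpa using h

variable [DecidableEq α]

/-- Since the buffer is refilled before each write, moving its contents back to the front of the
input changes nothing. Executions can therefore be indexed by the unwritten-element sequence alone.
-/
theorem OnlineAlgorithm.exec_eq_exec_nil (A : OnlineAlgorithm α) {K : ℕ} (n : ℕ) (s : A.State)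
    (last : Option α) {buf inp : List α} (hb : buf.length ≤ K) :
    A.exec K n s last buf inp = A.exec K n s last [] (buf ++ inp) := by
  cases n with
  | zero => rfl
  | succ n => simp [OnlineAlgorithm.exec, List.take_append, List.drop_append,
      List.take_of_length_le hb, List.drop_of_length_le hb]

theorem OnlineAlgorithm.exec_succ_of_none (A : OnlineAlgorithm α) {K n : ℕ} {s : A.State}
    {last : Option α} {u : List α} (h : A.step s last (u.take K) = none) :
    A.exec K (n + 1) s last [] u = [] := by
  simp [OnlineAlgorithm.exec, h]

theorem OnlineAlgorithm.exec_succ_of_some (A : OnlineAlgorithm α) {K n : ℕ} {s s' : A.State}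
    {last : Option α} {u : List α} {x : α} (h : A.step s last (u.take K) = some (x, s'))
    (hx : x ∈ u.take K) :
    A.exec K (n + 1) s last [] u = x :: A.exec K n s' (some x) [] (u.erase x) := by
  have hlen : ((u.take K).erase x).length ≤ K :=
    (List.erase_sublist.length_le).trans (List.length_take_le _ _)
  simp only [OnlineAlgorithm.exec, List.nil_append, List.length_nil, Nat.sub_zero, h]
  rw [A.exec_eq_exec_nil n s' (some x) hlen, ← List.erase_append_left _ hx, List.take_append_drop]

theorem OnlineAlgorithm.canWrite_exec (A : OnlineAlgorithm α) {K : ℕ} (hK : 0 < K)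
    (hA : ∀ s last b, b ≠ [] → ∃ x s', A.step s last b = some (x, s') ∧ x ∈ b)
    (n : ℕ) (s : A.State) (last : Option α) (buf inp : List α) (hb : buf.length ≤ K)
    (hn : buf.length + inp.length = n) : CanWrite K buf inp (A.exec K n s last buf inp) := by
  induction n generalizing s last buf inp with
  | zero =>
    obtain ⟨h1, h2⟩ : buf.length = 0 ∧ inp.length = 0 := by omega
    rw [List.length_eq_zero_iff] at h1 h2
    subst h1 h2
    exact .done
  | succ n ih =>
    refine CanWrite.fill (K - buf.length) (by omega) ?_
    have hne : buf ++ inp.take (K - buf.length) ≠ [] := by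
      intro h
      obtain ⟨rfl, h2⟩ := List.append_eq_nil_iff.1 h
      rcases List.take_eq_nil_iff.1 h2 with h2 | rfl
      · simp at h2
        omega
      · simp at hn
    have hlen : (buf ++ inp.take (K - buf.length)).length ≤ K := by
      simp; omega
    have htot : (buf ++ inp.take (K - buf.length)).length + (inp.drop (K - buf.length)).length
        = n + 1 := by
      simp; omega
    obtain ⟨x, s', hs, hx⟩ := hA s last _ hne
    simp only [OnlineAlgorithm.exec, hs]
    generalize buf ++ inp.take (K - buf.length) = full at *
    generalize inp.drop (K - buf.length) = rest at *
    obtain ⟨l₁, l₂, -, rfl, he⟩ := List.exists_erase_eq hx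
    rw [he]
    simp only [List.length_append, List.length_cons] at hlen htot
    exact .write (ih _ _ _ _ (by simp; omega) (by simp; omega))

end Exec

/-! ### Possible outputs -/

theorem CanWrite.perm {K : ℕ} {buf inp S : List α} (h : CanWrite K buf inp S) :
    S.Perm (buf ++ inp) := by
  induction h with
  | done => exact .refl _
  | read _ _ ih => simpa using ih
  | write _ ih =>
    refine (ih.cons _).trans ?_
    simpa using List.perm_middle.symm

/-- Ignoring some elements only frees slots: their reads and writes are skipped. -/
theorem CanWrite.filter {K : ℕ} {buf inp S : List α} (p : α → Bool) (h : CanWrite K buf inp S) :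
    CanWrite K (buf.filter p) (inp.filter p) (S.filter p) := by
  induction h with
  | done => exact .done
  | @read buf inp S x hfree _ ih =>
    by_cases hx : p x
    · rw [List.filter_cons_of_pos hx]
      refine .read ((List.length_filter_le _ _).trans_lt hfree) ?_
      simpa [hx] using ih
    · simpa [hx] using ih
  | @write l₁ l₂ inp S x _ ih =>
    by_cases hx : p x
    · rw [List.filter_append, List.filter_cons_of_pos hx, List.filter_cons_of_pos hx]
      refine .write ?_
      simpa using ih
    · simpa [hx] using ih

/-- Before the write with index `j`, only `j` slots have been freed, so at most the first `K + j`
elements have been seen. -/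
theorem CanWrite.getElem_mem_take {K : ℕ} {buf inp S : List α} (h : CanWrite K buf inp S)
    (hb : buf.length ≤ K) (j : ℕ) (hj : j < S.length) : S[j] ∈ (buf ++ inp).take (K + j) := by
  induction h generalizing j with
  | done => simp at hj
  | @read buf inp S x hfree _ ih => simpa using ih (by simpa using hfree) j hj
  | @write l₁ l₂ inp S x _ ih =>
    simp only [List.length_append, List.length_cons] at hb
    cases j with
    | zero =>
      rw [Nat.add_zero, List.take_append, List.mem_append, List.take_of_length_le (by simp; omega)]
      simp
    | succ j =>
      have := ih (by simp; omega) j (by simpa using hj)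
      simp only [List.getElem_cons_succ]
      rw [List.append_assoc, List.take_append, List.mem_append] at this
      rw [List.append_assoc, List.take_append, List.mem_append]
      rcases this with h | h
      · exact .inl (mem_take_of_le (by omega) h)
      · refine .inr ?_
        rw [show K + (j + 1) - l₁.length = (K + j - l₁.length) + 1 by omega, List.cons_append,
          List.take_succ_cons]
        exact List.mem_cons_of_mem _ h

theorem isOutput_self {K : ℕ} (hK : 0 < K) (I : List α) : IsOutput K I I := by
  induction I with
  | nil => exact .done
  | cons x I ih => exact .read hK (.write (l₁ := []) (l₂ := []) ih)

section Runs

variable [LinearOrder α]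

theorem exists_runs_eq_runCount (S : List α) :
    ∃ rs : List (List α), rs.length = runCount S ∧ (∀ r ∈ rs, IsRun r) ∧ rs.flatten = S := by
  refine Nat.sInf_mem (s := {k | ∃ rs : List (List α), rs.length = k ∧ (∀ r ∈ rs, IsRun r) ∧
    rs.flatten = S}) ⟨_, S.map fun x => [x], rfl, ?_, ?_⟩
  · simp [IsRun]
  · induction S <;> simp_all

theorem runCount_le {S : List α} {rs : List (List α)} (h : ∀ r ∈ rs, IsRun r)
    (hS : rs.flatten = S) : runCount S ≤ rs.length :=
  Nat.sInf_le ⟨rs, rfl, h, hS⟩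

/-- Copying the input is a possible output, so the infimum is attained and is not the default value
`0` of an empty set. -/
theorem exists_isOutput_runCount_eq_OPT {K : ℕ} (hK : 0 < K) (I : List α) :
    ∃ S : List α, IsOutput K I S ∧ runCount S = OPT K I :=
  Nat.sInf_mem (s := {k | ∃ S : List α, IsOutput K I S ∧ runCount S = k})
    ⟨_, I, isOutput_self hK I, rfl⟩

theorem IsRun.filter {r : List α} (p : α → Bool) (h : IsRun r) : IsRun (r.filter p) :=
  h.imp (fun h => h.filter p) fun h => h.filter p

theorem IsRun.exists_dir {r : List α} (h : IsRun r) (hr : r.Nodup) :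
    ∃ d : Dir, r.Pairwise fun a b => d.beyond a b = true := by
  rcases h with h | h
  · exact ⟨.up, (h.and hr).imp fun h => by simpa [Dir.beyond] using lt_of_le_of_ne h.1 h.2⟩
  · exact ⟨.down, (h.and hr).imp fun h => by simpa [Dir.beyond] using lt_of_le_of_ne h.1 h.2.symm⟩

theorem isRun_of_pairwise_beyond {d : Dir} {r : List α}
    (h : r.Pairwise fun a b => d.beyond a b = true) : IsRun r := by
  cases d
  · exact .inl (h.imp fun h => le_of_lt (by simpa [Dir.beyond] using h))
  · exact .inr (h.imp fun h => le_of_lt (by simpa [Dir.beyond] using h))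

/-! ### Maximal runs -/

/-- At most `n` further writes of a maximal run in direction `d`, when the last element written is
`last` and the unwritten-element sequence is `u`. -/
def continueRun (K : ℕ) (d : Dir) (n : ℕ) (last : Option α) (u : List α) : List α :=
  (maximalRunAlg α d).exec K n () last [] u

variable {K : ℕ} {d : Dir}

theorem maximalRun_eq_continueRun (u : List α) :
    maximalRun K d u = continueRun K d u.length none u := rfl

theorem continueRun_zero (last : Option α) (u : List α) : continueRun K d 0 last u = [] := rfl

theorem continueRun_succ_of_none {n : ℕ} {last : Option α} {u : List α}
    (h : d.next last (u.take K) = none) : continueRun K d (n + 1) last u = [] :=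
  (maximalRunAlg α d).exec_succ_of_none (by simp [maximalRunAlg, h])

theorem continueRun_succ_of_some {n : ℕ} {last : Option α} {u : List α} {x : α}
    (h : d.next last (u.take K) = some x) :
    continueRun K d (n + 1) last u = x :: continueRun K d n (some x) (u.erase x) :=
  (maximalRunAlg α d).exec_succ_of_some (by simp [maximalRunAlg, h]) (d.next_eq_some_iff.1 h).1

theorem continueRun_induction {motive : ℕ → Option α → List α → Prop}
    (zero : ∀ last u, motive 0 last u)
    (halt : ∀ n last u, d.next last (u.take K) = none → motive (n + 1) last u)
    (write : ∀ n last u x, d.next last (u.take K) = some x →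
      motive n (some x) (u.erase x) → motive (n + 1) last u)
    (n : ℕ) (last : Option α) (u : List α) : motive n last u := by
  induction n generalizing last u with
  | zero => exact zero _ _
  | succ n ih =>
    cases h : d.next last (u.take K) with
    | none => exact halt _ _ _ h
    | some x => exact write _ _ _ _ h (ih _ _)

theorem continueRun_pairwise (n : ℕ) (last : Option α) (u : List α) :
    (continueRun K d n last u).Pairwise (fun a b => d.beyond a b = true) ∧
      ∀ y ∈ continueRun K d n last u, d.Admissible last y := by
  induction n, last, u using continueRun_induction (α := α) (K := K) (d := d) with
  | zero last u => simp [continueRun_zero]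
  | halt n last u h => simp [continueRun_succ_of_none h]
  | write n last u x h ih =>
    have hx := d.next_eq_some_iff.1 h
    rw [continueRun_succ_of_some h]
    simp only [d.admissible_some] at ih
    refine ⟨List.pairwise_cons.2 ⟨ih.2, ih.1⟩, ?_⟩
    simp only [List.mem_cons, forall_eq_or_imp]
    exact ⟨hx.2.1, fun y hy => hx.2.1.of_beyond (ih.2 y hy)⟩

theorem continueRun_getElem_mem_take (n : ℕ) (last : Option α) (u : List α) (j : ℕ)
    (hj : j < (continueRun K d n last u).length) :
    (continueRun K d n last u)[j] ∈ u.take (K + j) := by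
  induction n, last, u using continueRun_induction (α := α) (K := K) (d := d) generalizing j with
  | zero last u => simp [continueRun_zero] at hj
  | halt n last u h => simp [continueRun_succ_of_none h] at hj
  | write n last u x h ih =>
    have hx := (d.next_eq_some_iff.1 h).1
    simp only [continueRun_succ_of_some h] at hj ⊢
    cases j with
    | zero => simpa using hx
    | succ j =>
      have := ih j (by simpa using hj)
      rw [take_erase_of_mem_take (mem_take_of_le (by omega) hx)] at this
      simpa [Nat.add_assoc] using List.mem_of_mem_erase this

theorem maximalRun_getElem_mem_take (u : List α) (j : ℕ) (hj : j < (maximalRun K d u).length) :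
    (maximalRun K d u)[j] ∈ u.take (K + j) :=
  continueRun_getElem_mem_take _ _ u j hj

theorem continueRun_subperm (n : ℕ) (last : Option α) (u : List α) :
    (continueRun K d n last u).Subperm u := by
  induction n, last, u using continueRun_induction (α := α) (K := K) (d := d) with
  | zero last u => simp [continueRun_zero]
  | halt n last u h => simp [continueRun_succ_of_none h]
  | write n last u x h ih =>
    have hx := List.mem_of_mem_take (d.next_eq_some_iff.1 h).1
    rw [continueRun_succ_of_some h]
    exact ((List.subperm_cons x).2 ih).trans (List.perm_cons_erase hx).symm.subperm

/-- The write budget only truncates a run; this relates the budget `3 * M` of the simulation to the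
budget `u.length` of `maximalRun`. -/
theorem continueRun_eq_take (n k : ℕ) (last : Option α) (u : List α) :
    continueRun K d n last u = (continueRun K d (n + k) last u).take n := by
  induction n, last, u using continueRun_induction (α := α) (K := K) (d := d) with
  | zero last u => simp [continueRun_zero]
  | halt n last u h =>
    rw [show n + 1 + k = n + k + 1 by omega, continueRun_succ_of_none h, continueRun_succ_of_none h,
      List.take_nil]
  | write n last u x h ih =>
    rw [show n + 1 + k = n + k + 1 by omega, continueRun_succ_of_some h, continueRun_succ_of_some h,
      List.take_succ_cons, ih]

theorem length_continueRun_none (n : ℕ) (u : List α) :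
    (continueRun K d n none u).length = min n (maximalRun K d u).length := by
  rw [maximalRun_eq_continueRun]
  rcases le_total n u.length with h | h
  · obtain ⟨k, hk⟩ := Nat.exists_eq_add_of_le h
    rw [hk, continueRun_eq_take n k, List.length_take]
  · obtain ⟨k, rfl⟩ := Nat.exists_eq_add_of_le h
    have h1 := (continueRun_subperm (K := K) (d := d) (u.length + k) none u).length_le
    rw [continueRun_eq_take (K := K) (d := d) u.length k, List.length_take]
    omega

/-- Exchange argument. Let `x` be the greedy choice. If `r` starts with `x`, both sequences drop it.
Otherwise all of `r` lies beyond `x`, so `r` can wait one write: its elements stay admissible and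
its windows only grow. The bound on `n` keeps the budget from ending the run early. -/
theorem subset_continueRun {n : ℕ} {last : Option α} {u r : List α} (hn : u.length ≤ n)
    (hr : r.Pairwise fun a b => d.beyond a b = true) (hadm : ∀ y ∈ r, d.Admissible last y)
    (hmem : ∀ j (hj : j < r.length), r[j] ∈ u.take (K + j)) :
    r ⊆ continueRun K d n last u := by
  induction n, last, u using continueRun_induction (α := α) (K := K) (d := d) generalizing r with
  | zero last u =>
    have hu : u = [] := List.length_eq_zero_iff.1 (by omega)
    cases r with
    | nil => simp
    | cons a r => simpa [hu] using hmem 0 (Nat.succ_pos _)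
  | halt n last u h =>
    cases r with
    | nil => simp
    | cons a r =>
      exact absurd (hadm a (by simp)) (d.next_eq_none_iff.1 h a (hmem 0 (Nat.succ_pos _)))
  | write n last u x h ih =>
    have hx := d.next_eq_some_iff.1 h
    rw [continueRun_succ_of_some h]
    have hlen : (u.erase x).length ≤ n := by
      rw [List.length_erase_of_mem (List.mem_of_mem_take hx.1)]
      omega
    cases r with
    | nil => simp
    | cons a r =>
      rw [List.pairwise_cons] at hr
      by_cases hax : a = x
      · subst hax
        refine List.cons_subset_cons _ (ih hlen hr.2 ?_ ?_)
        · simpa only [d.admissible_some] using hr.1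
        · intro j hj
          rw [mem_take_erase_iff hx.1 (d.ne_of_beyond (hr.1 _ (List.getElem_mem hj)))]
          exact hmem (j + 1) (Nat.succ_lt_succ hj)
      · have hxa : d.beyond x a = true :=
          hx.2.2 a (hmem 0 (Nat.succ_pos _)) (hadm a (by simp)) hax
        have hxr : ∀ y ∈ a :: r, d.beyond x y = true := by
          simp only [List.mem_cons, forall_eq_or_imp]
          exact ⟨hxa, fun y hy => d.beyond_trans hxa (hr.1 y hy)⟩
        refine List.subset_cons_of_subset _ (ih hlen (List.pairwise_cons.2 hr) ?_ ?_)
        · simpa only [d.admissible_some] using hxr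
        · intro j hj
          rw [mem_take_erase_iff hx.1 (d.ne_of_beyond (hxr _ (List.getElem_mem hj)))]
          exact mem_take_of_le (by omega) (hmem j hj)

theorem subset_maximalRun {u r : List α}
    (hr : r.Pairwise fun a b => d.beyond a b = true)
    (hmem : ∀ j (hj : j < r.length), r[j] ∈ u.take (K + j)) : r ⊆ maximalRun K d u :=
  subset_continueRun le_rfl hr (fun y _ => d.admissible_none y) hmem

theorem take_subset_maximalRun (u : List α) : u.take K ⊆ maximalRun K d u := by
  intro x hx
  -- A single buffered element is itself a feasible run.
  refine subset_maximalRun (r := [x]) (by simp) ?_ (by simp)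
  intro j hj
  obtain rfl : j = 0 := by simpa using hj
  simpa using hx

theorem maximalRun_pairwise (u : List α) :
    (maximalRun K d u).Pairwise fun a b => d.beyond a b = true :=
  (continueRun_pairwise _ _ _).1

theorem pairwise_beyond_nodup {r : List α} (hr : r.Pairwise fun a b => d.beyond a b = true) :
    r.Nodup :=
  hr.imp fun h => (d.ne_of_beyond h).symm

theorem maximalRun_ne_nil (hK : 0 < K) {u : List α} (hu : u ≠ []) : maximalRun K d u ≠ [] := by
  obtain ⟨a, u, rfl⟩ := List.exists_cons_of_ne_nil hu
  obtain ⟨K, rfl⟩ := Nat.exists_eq_succ_of_ne_zero hK.ne'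
  exact List.ne_nil_of_mem (take_subset_maximalRun _ (by simp : a ∈ List.take (K + 1) (a :: u)))

/-! ### One of the two maximal runs is short -/

theorem beyond_of_not_mem_take {u : List α} {M i : ℕ} (hM : M < (maximalRun K d u).length)
    (hi : i < (maximalRun K d u).length) (h : (maximalRun K d u)[i] ∉ u.take (K + M)) :
    d.beyond (maximalRun K d u)[M] (maximalRun K d u)[i] = true := by
  have hMi : M < i := by
    by_contra hle
    exact h (mem_take_of_le (by omega) (maximalRun_getElem_mem_take u i hi))
  exact List.pairwise_iff_getElem.1 (maximalRun_pairwise u) M i hM hi hMi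

theorem take_maximalRun_subset (u : List α) (n : ℕ) :
    (maximalRun K d u).take (n + 1) ⊆ u.take (K + n) := by
  intro x hx
  obtain ⟨i, hi, rfl⟩ := List.mem_iff_getElem.1 hx
  rw [List.length_take] at hi
  rw [List.getElem_take]
  exact mem_take_of_le (by omega) (maximalRun_getElem_mem_take u i (by omega))

theorem maximalRun_up_or_down_length_lt {M : ℕ} (hM : 0 < M) {u : List α} (hu : u.Nodup) :
    (maximalRun M .up u).length < 3 * M ∨ (maximalRun M .down u).length < 3 * M := by
  by_contra! hcon
  obtain ⟨hU, hD⟩ := hcon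
  -- This avoids subtraction: `3 * m + 2 + 1` is `3 * M`, and `M + (3 * m + 2)` is `4 * M - 1`, the
  -- number of elements visible by the last of `3 * M` writes.
  obtain ⟨m, rfl⟩ : ∃ m, M = m + 1 := ⟨M - 1, by omega⟩
  set M := m + 1
  have cardtake : ∀ (l : List α), l.Nodup → ∀ n, (l.take n).toFinset.card = min n l.length := by
    intro l hl n
    rw [List.toFinset_card_of_nodup (hl.sublist (List.take_sublist _ _)), List.length_take]
  have nodup : ∀ d : Dir, (maximalRun M d u).Nodup := fun d =>
    pairwise_beyond_nodup (maximalRun_pairwise u)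
  have sub : ∀ (d : Dir) n,
      ((maximalRun M d u).take (n + 1)).toFinset ⊆ (u.take (M + n)).toFinset := fun d n x hx =>
    List.mem_toFinset.2 (take_maximalRun_subset u n (List.mem_toFinset.1 hx))
  have hUM : M < (maximalRun M .up u).length := by omega
  have hDM : M < (maximalRun M .down u).length := by omega
  -- Otherwise the first `M + 1` elements of the two runs are separated in value, giving `2 * M + 2`
  -- distinct elements among the first `2 * M` of `u`.
  have cross : (maximalRun M .down u)[M] ≤ (maximalRun M .up u)[M] := by
    by_contra! hlt
    have hdisj : Disjoint ((maximalRun M .up u).take (M + 1)).toFinset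
        ((maximalRun M .down u).take (M + 1)).toFinset := by
      rw [Finset.disjoint_left]
      intro x hx hx'
      rw [List.mem_toFinset] at hx hx'
      obtain ⟨i, hi, rfl⟩ := List.mem_iff_getElem.1 hx
      obtain ⟨k, hk, hki⟩ := List.mem_iff_getElem.1 hx'
      rw [List.length_take] at hi hk
      rw [List.getElem_take] at hki
      rw [List.getElem_take] at hki
      have h1 : (maximalRun M .up u)[i] ≤ (maximalRun M .up u)[M] := by
        rcases eq_or_lt_of_le (show i ≤ M by omega) with h | h
        · simp [h]
        · have := List.pairwise_iff_getElem.1 (maximalRun_pairwise (d := .up) u) i M (by omega) hUM h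
          exact le_of_lt (by simpa [Dir.beyond] using this)
      have h2 : (maximalRun M .down u)[M] ≤ (maximalRun M .down u)[k] := by
        rcases eq_or_lt_of_le (show k ≤ M by omega) with h | h
        · simp [h]
        · have := List.pairwise_iff_getElem.1 (maximalRun_pairwise (d := .down) u) k M (by omega)
            hDM h
          exact le_of_lt (by simpa [Dir.beyond] using this)
      exact absurd (hlt.trans_le (h2.trans (hki.le.trans h1))) (lt_irrefl _)
    have := Finset.card_le_card (Finset.union_subset (sub .up M) (sub .down M))
    rw [Finset.card_union_of_disjoint hdisj, cardtake _ (nodup _), cardtake _ (nodup _),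
      cardtake _ hu] at this
    omega
  -- An element arriving after the first `2 * M` has index above `M` in any run containing it, so by
  -- `cross` it cannot be in both runs. Each run misses at most `M - 1` of the `4 * M - 1` visible
  -- elements, too few to account for the `2 * M - 1` late ones.
  have key : (u.take (M + (3 * m + 2))).toFinset \ (u.take (M + M)).toFinset ⊆
      ((u.take (M + (3 * m + 2))).toFinset \
        ((maximalRun M .up u).take (3 * m + 2 + 1)).toFinset) ∪
      ((u.take (M + (3 * m + 2))).toFinset \
        ((maximalRun M .down u).take (3 * m + 2 + 1)).toFinset) := by
    intro z hz
    rw [Finset.mem_sdiff] at hz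
    rw [Finset.mem_union, Finset.mem_sdiff, Finset.mem_sdiff]
    by_contra hnot
    have hzU : z ∈ maximalRun M .up u :=
      List.mem_of_mem_take (List.mem_toFinset.1 (by tauto :
        z ∈ ((maximalRun M .up u).take (3 * m + 2 + 1)).toFinset))
    have hzD : z ∈ maximalRun M .down u :=
      List.mem_of_mem_take (List.mem_toFinset.1 (by tauto :
        z ∈ ((maximalRun M .down u).take (3 * m + 2 + 1)).toFinset))
    have hz2 : z ∉ u.take (M + M) := fun h => hz.2 (List.mem_toFinset.2 h)
    obtain ⟨i, hi, rfl⟩ := List.mem_iff_getElem.1 hzU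
    obtain ⟨k, hk, hki⟩ := List.mem_iff_getElem.1 hzD
    have h1 := beyond_of_not_mem_take hUM hi hz2
    have h2 := beyond_of_not_mem_take hDM hk (by rwa [hki])
    simp only [Dir.beyond, decide_eq_true_eq] at h1 h2
    exact absurd (h1.trans (hki ▸ h2)) (not_lt.2 cross)
  have h1 := (Finset.card_le_card key).trans (Finset.card_union_le _ _)
  have h2 := Finset.le_card_sdiff (u.take (M + M)).toFinset (u.take (M + (3 * m + 2))).toFinset
  rw [Finset.card_sdiff_of_subset (sub .up _), Finset.card_sdiff_of_subset (sub .down _),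
    cardtake _ (nodup _), cardtake _ (nodup _), cardtake _ hu] at h1
  rw [cardtake _ hu, cardtake _ hu] at h2
  -- At least `3 * M` elements are visible, so the truncated subtractions above are genuine, even
  -- when `u` is shorter than `4 * M - 1`.
  have := Finset.card_le_card (sub .up (3 * m + 2))
  rw [cardtake _ (nodup _), cardtake _ hu] at this
  omega

/-! ### The simulation finds the greedy direction -/

/-- The simulation never erases its past choices from `b`, whereas the real run erases them from
`u`. Erased elements are no longer admissible, so agreement on admissible elements suffices. -/
theorem simulate_eq {M : ℕ} {b u : List α} {n t : ℕ} {last : Option α}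
    (h : ∀ y, d.Admissible last y → ∀ k < n, (y ∈ b.take (M + t + k) ↔ y ∈ u.take (M + k))) :
    simulate M d b n t last = t + (continueRun M d n last u).length := by
  induction n, last, u using continueRun_induction (α := α) (K := M) (d := d) generalizing t with
  | zero last u => simp [simulate, continueRun_zero]
  | halt n last u hx =>
    have hb : d.next last (b.take (M + t)) = none := by
      rw [← hx]
      exact d.next_congr fun y hy => by simpa using h y hy 0 (by omega)
    simp [simulate, continueRun_succ_of_none hx, hb]
  | write n last u x hx ih =>
    have hb : d.next last (b.take (M + t)) = some x := by
      rw [← hx]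
      exact d.next_congr fun y hy => by simpa using h y hy 0 (by omega)
    have hx' := d.next_eq_some_iff.1 hx
    simp only [simulate, hb, continueRun_succ_of_some hx, List.length_cons]
    rw [ih]
    · omega
    · intro y hy k hk
      rw [d.admissible_some] at hy
      rw [mem_take_erase_iff hx'.1 (d.ne_of_beyond hy), Nat.add_assoc M k 1,
        ← h y (hx'.2.1.of_beyond hy) (k + 1) (by omega)]
      rw [show M + (t + 1) + k = M + t + (k + 1) by omega]

theorem simLength_take (M : ℕ) (d : Dir) (u : List α) :
    simLength M d (u.take (4 * M)) = min (3 * M) (maximalRun M d u).length := by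
  rw [simLength, simulate_eq (u := u), length_continueRun_none, Nat.zero_add]
  intro y _ k hk
  rw [List.take_take, min_eq_left (by omega), Nat.add_zero]

theorem chooseDir_take {M : ℕ} (hM : 0 < M) {u : List α} (hu : u.Nodup) :
    chooseDir M (u.take (4 * M)) = greedyDir M u := by
  have := maximalRun_up_or_down_length_lt hM hu
  rw [chooseDir, greedyDir, simLength_take, simLength_take]
  congr 1
  apply propext
  omega

/-! ### The runs written by the algorithm -/

/-- At a decision point the old direction and the last element are forgotten, so each run starts
afresh on the unwritten elements. -/
theorem augAlg_step_none (M : ℕ) (last last' : Option α) (s : Option Dir) (b : List α)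
    (h : s.bind (fun d => d.next last b) = none) :
    (augAlg α M).step s last b = (augAlg α M).step none last' b := by
  simp [augAlg, h]

theorem exec_congr_of_step_eq (A : OnlineAlgorithm α) {s s' : A.State} {last last' : Option α}
    {u : List α} (h : A.step s last (u.take K) = A.step s' last' (u.take K)) (n : ℕ) :
    A.exec K n s last [] u = A.exec K n s' last' [] u := by
  cases n with
  | zero => rfl
  | succ n => simp [OnlineAlgorithm.exec, h]

theorem augAlg_exec_some (M n : ℕ) (last : Option α) (u : List α) :
    (augAlg α M).exec K n (show (augAlg α M).State from some d) last [] u =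
      continueRun K d n last u ++ (augAlg α M).exec K (n - (continueRun K d n last u).length)
        none none [] (u.diff (continueRun K d n last u)) := by
  induction n, last, u using continueRun_induction (α := α) (K := K) (d := d) with
  | zero last u => rfl
  | halt n last u h =>
    rw [continueRun_succ_of_none h]
    exact exec_congr_of_step_eq _ (augAlg_step_none M last none (some d) _ (by simpa using h)) _
  | write n last u x h ih =>
    rw [continueRun_succ_of_some h, (augAlg α M).exec_succ_of_some (s' := some d) (x := x)
      (by simp [augAlg, h]) (d.next_eq_some_iff.1 h).1, ih]
    simp

theorem augAlg_exec_none (M n : ℕ) (u : List α) :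
    (augAlg α M).exec K n none none [] u =
      (augAlg α M).exec K n (some (chooseDir M (u.take K))) none [] u := by
  apply exec_congr_of_step_eq
  simp only [augAlg, Option.bind_none, Option.bind_some]
  cases (chooseDir M (u.take K)).next none (u.take K) <;> rfl

theorem exists_greedyRuns {M : ℕ} (hM : 0 < M) (n : ℕ) {u : List α} (hn : u.length = n)
    (hu : u.Nodup) : ∃ rs : List (List α), GreedyRuns M (4 * M) u rs ∧
      rs.flatten = (augAlg α M).exec (4 * M) n none none [] u := by
  induction n using Nat.strong_induction_on generalizing u with
  | _ n ih =>
    by_cases hnil : u = []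
    · subst hnil
      subst hn
      exact ⟨[], .nil, rfl⟩
    · have hne := maximalRun_ne_nil (d := greedyDir M u) (show 0 < 4 * M by omega) hnil
      have hpos := List.length_pos_of_ne_nil hne
      have hsub : (maximalRun (4 * M) (greedyDir M u) u).Subperm u := continueRun_subperm _ _ _
      have hlen : (u.diff (maximalRun (4 * M) (greedyDir M u) u)).length =
          n - (maximalRun (4 * M) (greedyDir M u) u).length := by
        have := (List.subperm_append_diff_self_of_count_le fun x _ => hsub.count_le x).length_eq
        rw [List.length_append] at this
        omega
      have hle := hsub.length_le
      obtain ⟨rs, hrs, hfl⟩ := ih _ (by omega) hlen hu.diff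
      refine ⟨_, .cons hnil hrs, ?_⟩
      -- The budget equals the number of unwritten elements, so `continueRun` is `maximalRun` by
      -- definition and the leftover budget is the one used for `rs`.
      rw [augAlg_exec_none, augAlg_exec_some, chooseDir_take hM hu, List.flatten_cons, hfl, ← hn]
      rfl

theorem GreedyRuns.isRun {M : ℕ} {u : List α} {rs : List (List α)} (h : GreedyRuns M K u rs) :
    ∀ r ∈ rs, IsRun r := by
  induction h with
  | nil => simp
  | cons _ _ ih =>
    simp only [List.mem_cons, forall_eq_or_imp]
    exact ⟨isRun_of_pairwise_beyond (maximalRun_pairwise _), ih⟩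

theorem isOutput_augAlg {M : ℕ} (hK : 0 < K) (I : List α) :
    IsOutput K I ((augAlg α M).output K I) := by
  refine (augAlg α M).canWrite_exec hK ?_ _ _ _ _ _ (by simp) (by simp)
  intro s last b hb
  cases h : s.bind (fun d => d.next last b) with
  | some x =>
    refine ⟨x, s, by simp [augAlg, h], ?_⟩
    obtain ⟨d, -, hd⟩ := Option.bind_eq_some_iff.1 h
    exact (d.next_eq_some_iff.1 hd).1
  | none =>
    cases h' : (chooseDir M b).next none b with
    | some x =>
      exact ⟨x, some (chooseDir M b), by simp [augAlg, h, h'], (Dir.next_eq_some_iff _ |>.1 h').1⟩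
    | none =>
      obtain ⟨a, b, rfl⟩ := List.exists_cons_of_ne_nil hb
      exact absurd (Dir.admissible_none _ a) (Dir.next_eq_none_iff _ |>.1 h' a (by simp))

/-! ### Comparison with an arbitrary output -/

theorem length_maximalRun_lt_of_ne_greedyDir {M : ℕ} (hM : 0 < M) {u : List α} (hu : u.Nodup)
    (hd : d ≠ greedyDir M u) : (maximalRun M d u).length < 3 * M := by
  have := maximalRun_up_or_down_length_lt hM hu
  unfold greedyDir at hd
  split_ifs at hd with h <;> cases d <;> simp at hd <;> omega

/-- In the non-greedy direction, `r` has fewer than `3 * M` elements, so `M + j < 4 * M` and every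
`r[j]` is in the initial large buffer, which any maximal run empties. -/
theorem subset_maximalRun_greedyDir {M : ℕ} (hM : 0 < M) {u r : List α} (hu : u.Nodup)
    (hr : IsRun r) (hnd : r.Nodup) (hmem : ∀ j (hj : j < r.length), r[j] ∈ u.take (M + j)) :
    r ⊆ maximalRun (4 * M) (greedyDir M u) u := by
  obtain ⟨d, hd⟩ := hr.exists_dir hnd
  by_cases hdg : d = greedyDir M u
  · subst hdg
    exact subset_maximalRun hd fun j hj => mem_take_of_le (by omega) (hmem j hj)
  · have h1 := (List.subperm_of_subset hnd (subset_maximalRun hd hmem)).length_le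
    have h2 := length_maximalRun_lt_of_ne_greedyDir hM hu hdg
    intro x hx
    obtain ⟨j, hj, rfl⟩ := List.mem_iff_getElem.1 hx
    exact take_subset_maximalRun u (mem_take_of_le (by omega) (hmem j hj))

theorem GreedyRuns.length_le {M : ℕ} (hM : 0 < M) {u : List α} {gs rs : List (List α)}
    (h : GreedyRuns M (4 * M) u gs) (hu : u.Nodup) (hrs : ∀ r ∈ rs, IsRun r)
    (hout : IsOutput M u rs.flatten) : gs.length ≤ rs.length := by
  induction hk : rs.length generalizing u gs rs with
  | zero =>
    obtain rfl := List.length_eq_zero_iff.1 hk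
    have := CanWrite.perm hout
    cases h with
    | nil => simp
    | cons hne _ => exact absurd (by simpa using this.symm) hne
  | succ k ih =>
    obtain ⟨r, rs, rfl⟩ := List.exists_cons_of_length_eq_add_one hk
    cases h with
    | nil => simp
    | @cons _ gs _ h =>
      have hperm : (r ++ rs.flatten).Perm u := by simpa using CanWrite.perm hout
      have hnd : r.Nodup := (hperm.nodup_iff.2 hu).of_append_left
      set G := maximalRun (4 * M) (greedyDir M u) u with hG
      have hrG : r ⊆ G := by
        refine subset_maximalRun_greedyDir hM hu (hrs r (by simp)) hnd fun j hj => ?_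
        have := hout.getElem_mem_take (by simp) j (by simp; omega)
        simpa [List.getElem_append_left hj] using this
      -- Deleting `G` removes the first run entirely and keeps the others runs, possibly empty,
      -- giving an output on `u.diff G` with one run fewer.
      have hfilter := hout.filter (fun x => decide (x ∉ G))
      have hr0 : r.filter (fun x => decide (x ∉ G)) = [] := by
        rw [List.filter_eq_nil_iff]
        intro x hx
        simpa using hrG hx
      rw [List.flatten_cons, List.filter_append, hr0, List.nil_append, List.filter_flatten,
        List.filter_nil] at hfilter
      have hdiff : u.diff G = u.filter (fun x => decide (x ∉ G)) := by
        rw [hu.sdiff_eq_filter]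
      rw [hdiff] at h
      simpa using ih (rs := rs.map (List.filter fun x => decide (x ∉ G))) h (hu.filter _)
        (by
          simp only [List.mem_map, forall_exists_index, and_imp, forall_apply_eq_imp_iff₂]
          exact fun r hr => (hrs r (by simp [hr])).filter _)
        hfilter (by simpa using hk)

end Runs

end UpDown

/-! ### Assembly of the four claims. -/

theorem mainTheorem4 {α : Type*} [LinearOrder α] (M : ℕ) (hM : 0 < M) (I : List α)
    (hI : I.Nodup) :
    ((UpDown.maximalRun M .up I).length < 3 * M ∨
      (UpDown.maximalRun M .down I).length < 3 * M) ∧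
    UpDown.IsOutput (4 * M) I ((UpDown.augAlg α M).output (4 * M) I) ∧
    (∃ rs : List (List α), UpDown.GreedyRuns M (4 * M) I rs ∧
      rs.flatten = (UpDown.augAlg α M).output (4 * M) I ∧
      rs.length ≤ UpDown.OPT M I) ∧
    UpDown.runCount ((UpDown.augAlg α M).output (4 * M) I) ≤ UpDown.OPT M I := by
  obtain ⟨gs, hgs, hfl⟩ := UpDown.exists_greedyRuns hM I.length rfl hI
  obtain ⟨S, hS, hcount⟩ := UpDown.exists_isOutput_runCount_eq_OPT hM I
  obtain ⟨rs, hlen, hrs, rfl⟩ := UpDown.exists_runs_eq_runCount S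
  have hle : gs.length ≤ UpDown.OPT M I := by
    rw [← hcount, ← hlen]
    exact hgs.length_le hM hI hrs hS
  exact ⟨UpDown.maximalRun_up_or_down_length_lt hM hI, UpDown.isOutput_augAlg (by omega) I,
    ⟨gs, hgs, hfl, hle⟩, (UpDown.runCount_le hgs.isRun hfl).trans hle⟩
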